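/- Let $\mathbb R_+=[0,\infty)$ and let $X=\{X(\mathbf t),\ \mathbf t=(t_1,t_2)\in\mathbb R_+^2\}$ be a separable centered Gaussian random field with $\mathbf E X^2(1,1)=1$. Let $(H_1,H_2)\in(0,1)^2$ and $H=\min\{H_1,H_2\}$. Write $x\vee y=\max\{x,y\}$, and let $\stackrel{d}{=}$ denote equality of all finite-dimensional distributions. Suppose that * $X$ is self-similar with index $(H_1,H_2)$: for all $a_1,a_2>0$, $\{X(a_1t_1,a_2t_2),\ \mathbf t\in\mathbb R_+^2\}\stackrel{d}{=}\{a_1^{H_1}a_2^{H_2}X(\mathbf t),\ \mathbf t\in\mathbb R_+^2\}$; * $X$ has stationary rectangular increments: with $\Delta_{\mathbf u}X(\mathbf v)=X(v_1,v_2)-X(u_1,v_2)-X(v_1,u_2)+X(u_1,u_2)$, for every $\mathbf u\in\mathbb R_+^2$, $\{\Delta_{\mathbf u}X(\mathbf u+\mathbf h),\ \mathbf h\in\mathbb R_+^2\}\stackrel{d}{=}\{\Delta_{\mathbf 0}X(\mathbf h),\ \mathbf h\in\mathbb R_+^2\}$. Let $c:(0,\infty)\to(0,\infty)$ and a real sequence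 $(b_k)_{k\ge0}$ satisfy: 1. $c$ is non-decreasing on $[1,\infty)$, $c(t)\to\infty$ as $t\to\infty$, and $c(1/t)=c(t)$ for $t\ge1$; 2. $b_0=1$, $b_k<b_{k+1}$ for all $k\ge0$, $b_k\to\infty$, and, with $m_k:=\left(\frac{b_k}{b_{k+1}}\right)^{H_1+H_2}c(b_k)$, $M:=\inf_{k\ge0}m_k>0$; 3. $\sum_{k=1}^\infty \exp\{-D\,m_k\}<\infty$ for every $D>0$. For $\varepsilon>2/M$ put $$\widetilde Z(\varepsilon)=16\,e^{\frac2H+\frac12}\,\varepsilon^{4/H}\sum_{k=0}^\infty\exp\left\{-\frac{3\varepsilon^2}{2(4^{1-H}+3)}\,m_k^2\right\}m_k^{4/H}.$$ Then for every $\varepsilon>2/M$ this series converges and $$\mathbf P\left\{\sup_{\mathbf t\in\mathbb R_+^2\setminus\{\mathbf 0\}}\frac{|X(\mathbf t)|}{(t_1\vee t_2)^{H_1+H_2}\,c(t_1\vee t_2)}>\varepsilon\right\}\le\widetilde Z(\varepsilon).$$ Moreover, there is a real-valued random variable $\xi$ with $\mathbf P\{\xi>\varepsilon\}\le\widetilde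 Z(\varepsilon)$ for all $\varepsilon>2/M$ such that, with probability 1, for all $\mathbf t\in(0,\infty)^2$, $$|X(\mathbf t)|<\xi\,(t_1\vee t_2)^{H_1+H_2}\,c(t_1\vee t_2).$$ -/

import Mathlib

open MeasureTheory ProbabilityTheory Filter Topology
open scoped NNReal ENNReal

noncomputable section

/-- Equality of all finite-dimensional distributions of two real random fields on the same
probability space. -/
def SameFDD {T Ω : Type*} [MeasurableSpace Ω] (P : Measure Ω) (X Y : T → Ω → ℝ) : Prop :=
  ∀ I : Finset T,
    IdentDistrib (fun ω (i : I) => X (i : T) ω) (fun ω (i : I) => Y (i : T) ω) P P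

/-- Separability of a random field in the sense of Doob: there are a countable dense set `S` and
a null set outside which, for all open `G` and closed `F`, membership of the values in `F` along
`G ∩ S` forces it on all of `G`. -/
def IsSeparableField {T Ω : Type*} [TopologicalSpace T] [MeasurableSpace Ω]
    (P : Measure Ω) (X : T → Ω → ℝ) : Prop :=
  ∃ S : Set T, S.Countable ∧ Dense S ∧
    ∀ᵐ ω ∂P, ∀ G : Set T, IsOpen G → ∀ F : Set ℝ, IsClosed F →
      (∀ t ∈ G ∩ S, X t ω ∈ F) → ∀ t ∈ G, X t ω ∈ F

/-- Self-similarity with index `(H₁, H₂)` of a random field on the quadrant `[0, ∞)²`. -/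
def IsSelfSimilarField {Ω : Type*} [MeasurableSpace Ω] (P : Measure Ω)
    (X : ℝ≥0 × ℝ≥0 → Ω → ℝ) (H₁ H₂ : ℝ) : Prop :=
  ∀ a₁ a₂ : ℝ≥0, 0 < a₁ → 0 < a₂ →
    SameFDD P (fun t ω => X (a₁ * t.1, a₂ * t.2) ω)
      (fun t ω => (a₁ : ℝ) ^ H₁ * (a₂ : ℝ) ^ H₂ * X t ω)

/-- The rectangular increment of `X` over the rectangle with lower corner `u` and upper
corner `v`. -/
def rectIncrement {Ω : Type*} (X : ℝ≥0 × ℝ≥0 → Ω → ℝ) (u v : ℝ≥0 × ℝ≥0) (ω : Ω) : ℝ :=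
  X (v.1, v.2) ω - X (u.1, v.2) ω - X (v.1, u.2) ω + X (u.1, u.2) ω

/-- Stationarity of the rectangular increments. -/
def HasStationaryRectIncrements {Ω : Type*} [MeasurableSpace Ω] (P : Measure Ω)
    (X : ℝ≥0 × ℝ≥0 → Ω → ℝ) : Prop :=
  ∀ u : ℝ≥0 × ℝ≥0,
    SameFDD P (fun h ω => rectIncrement X u (u + h) ω) (fun h ω => rectIncrement X 0 h ω)

/-- The normalizing weight `(t₁ ∨ t₂) ^ (H₁ + H₂) * c (t₁ ∨ t₂)`. -/
def fieldWeight (H₁ H₂ : ℝ) (c : ℝ → ℝ) (t : ℝ≥0 × ℝ≥0) : ℝ :=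
  ((max t.1 t.2 : ℝ≥0) : ℝ) ^ (H₁ + H₂) * c ((max t.1 t.2 : ℝ≥0) : ℝ)

/-- The supremum of the normalized field over `[0, ∞)²` without the origin, with values in the
extended reals. -/
def normalizedSup {Ω : Type*} (X : ℝ≥0 × ℝ≥0 → Ω → ℝ) (H₁ H₂ : ℝ) (c : ℝ → ℝ) (ω : Ω) : EReal :=
  ⨆ t : {t : ℝ≥0 × ℝ≥0 // t ≠ 0}, ((|X t.1 ω| / fieldWeight H₁ H₂ c t.1 : ℝ) : EReal)

/-- The quantity `(b_k / b_{k+1}) ^ (H₁ + H₂) * c (b_k)`. -/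
def levelRatio (H₁ H₂ : ℝ) (c : ℝ → ℝ) (b : ℕ → ℝ) (k : ℕ) : ℝ :=
  (b k / b (k + 1)) ^ (H₁ + H₂) * c (b k)

/-- The `k`-th term of the series in the bound. -/
def ZtildeTerm (H₁ H₂ : ℝ) (c : ℝ → ℝ) (b : ℕ → ℝ) (ε : ℝ) (k : ℕ) : ℝ :=
  Real.exp (-(3 * ε ^ 2 / (2 * ((4 : ℝ) ^ (1 - min H₁ H₂) + 3))) * levelRatio H₁ H₂ c b k ^ 2) *
    levelRatio H₁ H₂ c b k ^ (4 / min H₁ H₂)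

/-- The bound `16 e^{2/H + 1/2} ε^{4/H} ∑ₖ …`, where `H = min H₁ H₂`. -/
def Ztilde (H₁ H₂ : ℝ) (c : ℝ → ℝ) (b : ℕ → ℝ) (ε : ℝ) : ℝ :=
  16 * Real.exp (2 / min H₁ H₂ + 1 / 2) * ε ^ (4 / min H₁ H₂) *
    ∑' k : ℕ, ZtildeTerm H₁ H₂ c b ε k

end

/-! Self-similarity and stationary increments determine the second moments: `E X(t)² = (t₁^H₁
t₂^H₂)²`, and the increment along one coordinate has the variance of the field at the corresponding
difference. After rescaling the square of side `T` to the unit square, the field divided by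
`T^(H₁+H₂)` has variance at most 1 and increments over distance `δ` of standard deviation at most `2
δ^H`. Chaining along finer and finer grids (`measureReal_exists_mem_finset_le`) then bounds the
probability that it exceeds `49/50 · u` by `8 e^(2/H+1/2) u^(4/H) exp(-3u²/8)` for `u ≥ 2`.

The quadrant without the origin is cut into shells `b_k ≤ t₁ ∨ t₂ < b_(k+1)` and their reflections
`1/b_(k+1) ≤ t₁ ∨ t₂ < 1/b_k`. On a shell the weight is at least `T^(H₁+H₂) m_k`, where `T` is the
outer radius (`exists_levelWeight_le_fieldWeight`). The square bound with `u = ε m_k ≥ 2` is summed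
over `k` and over both families, which turns 8 into 16. The exponent 3/8 is at least the one
required, because `4^(1-H) ≥ 1`.

All suprema are first taken over a countable separating set and carried to the quadrant by
separability. The factor 49/50 is spare room: it lets `ξ` be slightly larger than the supremum,
which makes the pathwise inequality strict without spoiling the tail bound. -/

/-! ### Gaussian tails -/

theorem HasGaussianLaw.measureReal_le_abs_le {Ω : Type*} [MeasurableSpace Ω] {P : Measure Ω}
    [IsProbabilityMeasure P] {Z : Ω → ℝ} (hZ : HasGaussianLaw Z P) (hmean : ∫ ω, Z ω ∂P = 0)
    {κ : ℝ} (hκ : 0 < κ) (hvar : ∫ ω, Z ω ^ 2 ∂P ≤ κ) {v : ℝ} (hv : 0 ≤ v) :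
    P.real {ω | v ≤ |Z ω|} ≤ 2 * Real.exp (-v ^ 2 / (2 * κ)) := by
  have hV : Var[Z; P] ≤ κ := by
    rw [variance_of_integral_eq_zero hZ.aemeasurable hmean]; exact hvar
  have hsub : ∀ {W : Ω → ℝ}, HasGaussianLaw W P → ∫ ω, W ω ∂P = 0 → Var[W; P] ≤ κ →
      P.real {ω | v ≤ W ω} ≤ Real.exp (-v ^ 2 / (2 * κ)) := by
    intro W hW hm hVW
    have hlaw := hW.map_eq_gaussianReal
    -- The Gaussian moment generating function is monotone in the variance, so `κ` may replace it; a
    -- degenerate law is covered too.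
    have hs : HasSubgaussianMGF W κ.toNNReal P := by
      refine ⟨fun t => ?_, fun t => ?_⟩
      · have h := integrable_exp_mul_gaussianReal (μ := P[W]) (v := Var[W; P].toNNReal) t
        rw [← hlaw] at h
        exact h.comp_aemeasurable hW.aemeasurable
      · rw [mgf_gaussianReal hlaw]
        apply Real.exp_le_exp.2
        rw [hm, Real.coe_toNNReal _ (variance_nonneg _ _), Real.coe_toNNReal _ hκ.le]
        nlinarith [sq_nonneg t]
    have h := hs.measure_ge_le hv
    rwa [Real.coe_toNNReal _ hκ.le] at h
  have h1 := hsub hZ hmean hV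
  have h2 := hsub (W := fun ω => -Z ω) hZ.fun_neg (by rw [integral_neg, hmean, neg_zero])
    (by rw [variance_fun_neg]; exact hV)
  have hset : {ω | v ≤ |Z ω|} ⊆ {ω | v ≤ Z ω} ∪ {ω | v ≤ -Z ω} := by
    intro ω (hω : v ≤ |Z ω|)
    exact le_abs.1 hω
  calc P.real {ω | v ≤ |Z ω|} ≤ P.real ({ω | v ≤ Z ω} ∪ {ω | v ≤ -Z ω}) := measureReal_mono hset
    _ ≤ _ := measureReal_union_le _ _
    _ ≤ _ := by linarith

/-! ### Second moments of the field and of its increments -/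

namespace SameFDD

theorem identDistrib {T Ω : Type*} [MeasurableSpace Ω] {P : Measure Ω} {X Y : T → Ω → ℝ}
    (h : SameFDD P X Y) (t : T) : IdentDistrib (X t) (Y t) P P :=
  (h {t}).comp (u := fun f : ({t} : Finset T) → ℝ => f ⟨t, Finset.mem_singleton_self t⟩)
    (by fun_prop)

theorem integral_sq_eq {T Ω : Type*} [MeasurableSpace Ω] {P : Measure Ω} {X Y : T → Ω → ℝ}
    (h : SameFDD P X Y) (t : T) : ∫ ω, X t ω ^ 2 ∂P = ∫ ω, Y t ω ^ 2 ∂P :=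
  ((h.identDistrib t).comp (u := fun x : ℝ => x ^ 2) (by fun_prop)).integral_eq

end SameFDD

section SecondMoments

variable {Ω : Type*} [MeasurableSpace Ω] {P : Measure Ω} {H₁ H₂ : ℝ} {X : ℝ≥0 × ℝ≥0 → Ω → ℝ}

theorem IsSelfSimilarField.integral_sq_scale (hss : IsSelfSimilarField P X H₁ H₂) {a₁ a₂ : ℝ≥0}
    (h₁ : 0 < a₁) (h₂ : 0 < a₂) (t : ℝ≥0 × ℝ≥0) :
    ∫ ω, X (a₁ * t.1, a₂ * t.2) ω ^ 2 ∂P =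
      ((a₁ : ℝ) ^ H₁ * (a₂ : ℝ) ^ H₂) ^ 2 * ∫ ω, X t ω ^ 2 ∂P := by
  rw [(hss a₁ a₂ h₁ h₂).integral_sq_eq t, ← integral_const_mul]
  simp only [mul_pow]

/-- Doubling the vanishing coordinate fixes the point but multiplies the second moment by `(2^H)² ≠
1`. -/
theorem IsSelfSimilarField.integral_sq_eq_zero (hss : IsSelfSimilarField P X H₁ H₂)
    (hH₁ : 0 < H₁) (hH₂ : 0 < H₂) {t : ℝ≥0 × ℝ≥0} (ht : t.1 = 0 ∨ t.2 = 0) :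
    ∫ ω, X t ω ^ 2 ∂P = 0 := by
  have key : ∀ {H : ℝ}, 0 < H → ((2 : ℝ) ^ H) ^ 2 ≠ 1 := fun {H} hH => by
    have := Real.one_lt_rpow (x := 2) (by norm_num) hH
    nlinarith
  rcases ht with ht | ht
  · have h := hss.integral_sq_scale (a₁ := 2) (a₂ := 1) (by norm_num) one_pos t
    have e : ((2 : ℝ≥0) * t.1, (1 : ℝ≥0) * t.2) = t := by ext <;> simp [ht]
    rw [e] at h
    simp only [NNReal.coe_ofNat, NNReal.coe_one, Real.one_rpow, mul_one] at h
    by_contra hne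
    exact key hH₁ (mul_right_cancel₀ hne (by rw [one_mul]; exact h.symm))
  · have h := hss.integral_sq_scale (a₁ := 1) (a₂ := 2) one_pos (by norm_num) t
    have e : ((1 : ℝ≥0) * t.1, (2 : ℝ≥0) * t.2) = t := by ext <;> simp [ht]
    rw [e] at h
    simp only [NNReal.coe_ofNat, NNReal.coe_one, Real.one_rpow, one_mul] at h
    by_contra hne
    exact key hH₂ (mul_right_cancel₀ hne (by rw [one_mul]; exact h.symm))

theorem IsSelfSimilarField.integral_sq_eq (hss : IsSelfSimilarField P X H₁ H₂)
    (hH₁ : 0 < H₁) (hH₂ : 0 < H₂) (hnorm : ∫ ω, X (1, 1) ω ^ 2 ∂P = 1) (t : ℝ≥0 × ℝ≥0) :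
    ∫ ω, X t ω ^ 2 ∂P = ((t.1 : ℝ) ^ H₁ * (t.2 : ℝ) ^ H₂) ^ 2 := by
  rcases eq_or_ne t.1 0 with h1 | h1
  · rw [hss.integral_sq_eq_zero hH₁ hH₂ (Or.inl h1), h1]
    simp [Real.zero_rpow hH₁.ne']
  rcases eq_or_ne t.2 0 with h2 | h2
  · rw [hss.integral_sq_eq_zero hH₁ hH₂ (Or.inr h2), h2]
    simp [Real.zero_rpow hH₂.ne']
  have h := hss.integral_sq_scale (pos_iff_ne_zero.2 h1) (pos_iff_ne_zero.2 h2) (1, 1)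
  simpa [hnorm] using h

theorem ProbabilityTheory.IsGaussianProcess.memLp_two_eval [IsProbabilityMeasure P]
    (hgauss : IsGaussianProcess X P) (t : ℝ≥0 × ℝ≥0) : MemLp (X t) 2 P :=
  (hgauss.hasGaussianLaw_eval t).memLp_two

theorem IsSelfSimilarField.ae_eq_zero [IsProbabilityMeasure P] (hss : IsSelfSimilarField P X H₁ H₂)
    (hgauss : IsGaussianProcess X P) (hH₁ : 0 < H₁) (hH₂ : 0 < H₂) {t : ℝ≥0 × ℝ≥0}
    (ht : t.1 = 0 ∨ t.2 = 0) : ∀ᵐ ω ∂P, X t ω = 0 := by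
  have h := hss.integral_sq_eq_zero hH₁ hH₂ ht
  rw [integral_eq_zero_iff_of_nonneg (fun ω => sq_nonneg _)
    (hgauss.memLp_two_eval t).integrable_sq] at h
  filter_upwards [h] with ω hω
  simpa using hω

/-- Since the field vanishes almost surely on the axes, the rectangular increment over a rectangle
standing on an axis reduces to an increment in one variable. -/
theorem HasStationaryRectIncrements.integral_sq_sub_fst [IsProbabilityMeasure P]
    (hstat : HasStationaryRectIncrements P X) (hss : IsSelfSimilarField P X H₁ H₂)
    (hgauss : IsGaussianProcess X P) (hH₁ : 0 < H₁) (hH₂ : 0 < H₂) (s h t : ℝ≥0) :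
    ∫ ω, (X (s + h, t) ω - X (s, t) ω) ^ 2 ∂P = ∫ ω, X (h, t) ω ^ 2 ∂P := by
  have hz : ∀ r, _ := fun r => hss.ae_eq_zero hgauss hH₁ hH₂ (t := (r, 0)) (Or.inr rfl)
  have hz' : ∀ r, _ := fun r => hss.ae_eq_zero hgauss hH₁ hH₂ (t := (0, r)) (Or.inl rfl)
  have e := (hstat (s, 0)).integral_sq_eq (h, t)
  calc _ = ∫ ω, rectIncrement X (s, 0) ((s, 0) + (h, t)) ω ^ 2 ∂P := by
        apply integral_congr_ae
        filter_upwards [hz s, hz (s + h)] with ω h1 h2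
        simp [rectIncrement, h1, h2]
    _ = _ := e
    _ = _ := by
        apply integral_congr_ae
        filter_upwards [hz 0, hz h, hz' t] with ω h1 h2 h3
        simp only [rectIncrement, Prod.fst_zero, Prod.snd_zero, h1, h2, h3]
        simp

theorem HasStationaryRectIncrements.integral_sq_sub_snd [IsProbabilityMeasure P]
    (hstat : HasStationaryRectIncrements P X) (hss : IsSelfSimilarField P X H₁ H₂)
    (hgauss : IsGaussianProcess X P) (hH₁ : 0 < H₁) (hH₂ : 0 < H₂) (s h t : ℝ≥0) :
    ∫ ω, (X (t, s + h) ω - X (t, s) ω) ^ 2 ∂P = ∫ ω, X (t, h) ω ^ 2 ∂P := by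
  have hz : ∀ r, _ := fun r => hss.ae_eq_zero hgauss hH₁ hH₂ (t := (r, 0)) (Or.inr rfl)
  have hz' : ∀ r, _ := fun r => hss.ae_eq_zero hgauss hH₁ hH₂ (t := (0, r)) (Or.inl rfl)
  have e := (hstat (0, s)).integral_sq_eq (t, h)
  calc _ = ∫ ω, rectIncrement X (0, s) ((0, s) + (t, h)) ω ^ 2 ∂P := by
        apply integral_congr_ae
        filter_upwards [hz' s, hz' (s + h)] with ω h1 h2
        simp [rectIncrement, h1, h2]
    _ = _ := e
    _ = _ := by
        apply integral_congr_ae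
        filter_upwards [hz 0, hz t, hz' h] with ω h1 h2 h3
        simp only [rectIncrement, Prod.fst_zero, Prod.snd_zero, h1, h2, h3]
        simp

/-- Bound on the second moment of an increment within the square of side `T`. -/
theorem HasStationaryRectIncrements.integral_sq_sub_le [IsProbabilityMeasure P]
    (hstat : HasStationaryRectIncrements P X) (hss : IsSelfSimilarField P X H₁ H₂)
    (hgauss : IsGaussianProcess X P) (hH₁ : 0 < H₁) (hH₂ : 0 < H₂)
    (hnorm : ∫ ω, X (1, 1) ω ^ 2 ∂P = 1) {T δ : ℝ} (hT : 0 < T) (hδ : 0 < δ) (hδ1 : δ ≤ 1)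
    {s t : ℝ≥0 × ℝ≥0} (hs₁ : (s.1 : ℝ) ≤ T) (ht₂ : (t.2 : ℝ) ≤ T)
    (h₁ : |(t.1 : ℝ) - s.1| ≤ T * δ) (h₂ : |(t.2 : ℝ) - s.2| ≤ T * δ) :
    ∫ ω, (X t ω - X s ω) ^ 2 ∂P ≤ (2 * (T ^ (H₁ + H₂) * δ ^ min H₁ H₂)) ^ 2 := by
  have hfst : ∀ x y z : ℝ≥0, ∫ ω, (X (x, z) ω - X (y, z) ω) ^ 2 ∂P =
      (|(x : ℝ) - y| ^ H₁ * (z : ℝ) ^ H₂) ^ 2 := by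
    intro x y z
    rcases le_total y x with h | h
    · obtain ⟨d, rfl⟩ := exists_add_of_le h
      rw [hstat.integral_sq_sub_fst hss hgauss hH₁ hH₂, hss.integral_sq_eq hH₁ hH₂ hnorm]
      simp
    · obtain ⟨d, rfl⟩ := exists_add_of_le h
      have e := hstat.integral_sq_sub_fst hss hgauss hH₁ hH₂ x d z
      rw [hss.integral_sq_eq hH₁ hH₂ hnorm] at e
      simp_rw [sub_sq_comm (X (x, z) _)]
      rw [e]
      simp [abs_of_nonneg]
  have hsnd : ∀ x y z : ℝ≥0, ∫ ω, (X (z, x) ω - X (z, y) ω) ^ 2 ∂P =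
      ((z : ℝ) ^ H₁ * |(x : ℝ) - y| ^ H₂) ^ 2 := by
    intro x y z
    rcases le_total y x with h | h
    · obtain ⟨d, rfl⟩ := exists_add_of_le h
      rw [hstat.integral_sq_sub_snd hss hgauss hH₁ hH₂, hss.integral_sq_eq hH₁ hH₂ hnorm]
      simp
    · obtain ⟨d, rfl⟩ := exists_add_of_le h
      have e := hstat.integral_sq_sub_snd hss hgauss hH₁ hH₂ x d z
      rw [hss.integral_sq_eq hH₁ hH₂ hnorm] at e
      simp_rw [sub_sq_comm (X (z, x) _)]
      rw [e]
      simp [abs_of_nonneg]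
  have hint : ∀ p q : ℝ≥0 × ℝ≥0, Integrable (fun ω => (X p ω - X q ω) ^ 2) P := fun p q =>
    ((hgauss.memLp_two_eval p).sub (hgauss.memLp_two_eval q)).integrable_sq
  have hb₁ : |(t.1 : ℝ) - s.1| ^ H₁ * (t.2 : ℝ) ^ H₂ ≤ T ^ (H₁ + H₂) * δ ^ min H₁ H₂ := by
    calc |(t.1 : ℝ) - s.1| ^ H₁ * (t.2 : ℝ) ^ H₂ ≤ (T * δ) ^ H₁ * T ^ H₂ := by gcongr
      _ = T ^ (H₁ + H₂) * δ ^ H₁ := by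
          rw [Real.mul_rpow hT.le hδ.le, Real.rpow_add hT]; ring
      _ ≤ _ := by
          gcongr ?_ * ?_
          exact Real.rpow_le_rpow_of_exponent_ge hδ hδ1 (min_le_left _ _)
  have hb₂ : (s.1 : ℝ) ^ H₁ * |(t.2 : ℝ) - s.2| ^ H₂ ≤ T ^ (H₁ + H₂) * δ ^ min H₁ H₂ := by
    calc (s.1 : ℝ) ^ H₁ * |(t.2 : ℝ) - s.2| ^ H₂ ≤ T ^ H₁ * (T * δ) ^ H₂ := by gcongr
      _ = T ^ (H₁ + H₂) * δ ^ H₂ := by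
          rw [Real.mul_rpow hT.le hδ.le, Real.rpow_add hT]; ring
      _ ≤ _ := by
          gcongr ?_ * ?_
          exact Real.rpow_le_rpow_of_exponent_ge hδ hδ1 (min_le_right _ _)
  -- The path from `s` to `t` turns at the corner `(s.1, t.2)`, which is why only `s.1` and `t.2`
  -- need to be bounded by `T`.
  calc ∫ ω, (X t ω - X s ω) ^ 2 ∂P
      ≤ ∫ ω, (2 * (X (t.1, t.2) ω - X (s.1, t.2) ω) ^ 2
          + 2 * (X (s.1, t.2) ω - X (s.1, s.2) ω) ^ 2) ∂P := by
        apply integral_mono (hint t s) (((hint _ _).const_mul 2).add ((hint _ _).const_mul 2))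
        intro ω
        simp only [Prod.mk.eta, Pi.add_apply]
        nlinarith [sq_nonneg (X t ω - X (s.1, t.2) ω - (X (s.1, t.2) ω - X s ω))]
    _ = 2 * (|(t.1 : ℝ) - s.1| ^ H₁ * (t.2 : ℝ) ^ H₂) ^ 2
          + 2 * ((s.1 : ℝ) ^ H₁ * |(t.2 : ℝ) - s.2| ^ H₂) ^ 2 := by
        rw [integral_add ((hint _ _).const_mul 2) ((hint _ _).const_mul 2), integral_const_mul,
          integral_const_mul, hfst, hsnd]
    _ ≤ 2 * (T ^ (H₁ + H₂) * δ ^ min H₁ H₂) ^ 2 + 2 * (T ^ (H₁ + H₂) * δ ^ min H₁ H₂) ^ 2 := by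
        gcongr
    _ = _ := by ring

end SecondMoments

/-! ### Grids and discrete chaining -/

/-- The uniform grid of mesh `1 / k` in the unit square. -/
noncomputable def unitGrid (k : ℕ) : Finset (ℝ≥0 × ℝ≥0) :=
  (Finset.range (k + 1) ×ˢ Finset.range (k + 1)).image
    fun p => ((p.1 : ℝ≥0) / k, (p.2 : ℝ≥0) / k)

/-- The lower left corner of the cell of mesh `1 / k` that contains `t`. -/
noncomputable def gridFloor (k : ℕ) (t : ℝ≥0 × ℝ≥0) : ℝ≥0 × ℝ≥0 :=
  ((⌊k * t.1⌋₊ : ℝ≥0) / k, (⌊k * t.2⌋₊ : ℝ≥0) / k)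

theorem card_unitGrid_le (k : ℕ) : ((unitGrid k).card : ℝ) ≤ ((k : ℝ) + 1) ^ 2 := by
  have h : (unitGrid k).card ≤ (k + 1) * (k + 1) := by
    refine Finset.card_image_le.trans ?_
    simp
  calc ((unitGrid k).card : ℝ) ≤ (((k + 1) * (k + 1) : ℕ) : ℝ) := by exact_mod_cast h
    _ = _ := by push_cast; ring

theorem le_one_of_mem_unitGrid {k : ℕ} {t : ℝ≥0 × ℝ≥0} (ht : t ∈ unitGrid k) :
    t.1 ≤ 1 ∧ t.2 ≤ 1 := by
  simp only [unitGrid, Finset.mem_image, Finset.mem_product, Finset.mem_range] at ht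
  obtain ⟨p, ⟨h1, h2⟩, rfl⟩ := ht
  constructor
  · exact div_le_one_of_le₀ (by exact_mod_cast Nat.lt_succ_iff.1 h1) zero_le
  · exact div_le_one_of_le₀ (by exact_mod_cast Nat.lt_succ_iff.1 h2) zero_le

theorem gridFloor_mem_unitGrid (k : ℕ) {t : ℝ≥0 × ℝ≥0} (h₁ : t.1 ≤ 1) (h₂ : t.2 ≤ 1) :
    gridFloor k t ∈ unitGrid k := by
  have aux : ∀ x : ℝ≥0, x ≤ 1 → ⌊(k : ℝ≥0) * x⌋₊ < k + 1 := by
    intro x hx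
    refine Nat.lt_succ_of_le ((Nat.floor_mono (mul_le_of_le_one_right zero_le hx)).trans ?_)
    simp
  simp only [unitGrid, Finset.mem_image, Finset.mem_product, Finset.mem_range]
  exact ⟨(_, _), ⟨aux _ h₁, aux _ h₂⟩, rfl⟩

theorem abs_sub_floor_div_le {k : ℕ} (hk : 0 < k) (x : ℝ≥0) :
    |(x : ℝ) - (((⌊k * x⌋₊ : ℝ≥0) / k : ℝ≥0) : ℝ)| ≤ 1 / k := by
  have hk' : (0 : ℝ) < k := by exact_mod_cast hk
  have h1 : ((⌊(k : ℝ≥0) * x⌋₊ : ℝ≥0) : ℝ) ≤ k * x := by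
    exact_mod_cast Nat.floor_le (zero_le (a := (k : ℝ≥0) * x))
  have h2 : (k : ℝ) * x < ((⌊(k : ℝ≥0) * x⌋₊ : ℝ≥0) : ℝ) + 1 := by
    exact_mod_cast Nat.lt_floor_add_one ((k : ℝ≥0) * x)
  rw [NNReal.coe_div, NNReal.coe_natCast k]
  have e : (x : ℝ) - ((⌊(k : ℝ≥0) * x⌋₊ : ℝ≥0) : ℝ) / k =
      (k * x - ((⌊(k : ℝ≥0) * x⌋₊ : ℝ≥0) : ℝ)) / k := by field_simp
  rw [e, abs_of_nonneg (div_nonneg (by linarith) hk'.le)]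
  gcongr
  linarith

/-- Discrete chaining along a sequence of grids. -/
theorem measureReal_exists_unitGrid_le {Ω : Type*} [MeasurableSpace Ω] {P : Measure Ω}
    [IsProbabilityMeasure P] {Y : ℝ≥0 × ℝ≥0 → Ω → ℝ} (k : ℕ → ℕ) (v : ℝ) (s : ℕ → ℝ) (m : ℕ) :
    P.real {ω | ∃ q ∈ unitGrid (k m), v + ∑ n ∈ Finset.range m, s n < |Y q ω|} ≤
      (∑ q ∈ unitGrid (k 0), P.real {ω | v ≤ |Y q ω|}) +
      ∑ n ∈ Finset.range m, ∑ q ∈ unitGrid (k (n + 1)),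
        P.real {ω | s n ≤ |Y q ω - Y (gridFloor (k n) q) ω|} := by
  induction m with
  | zero =>
    simp only [Finset.range_zero, Finset.sum_empty, add_zero]
    refine le_trans (measureReal_mono ?_ (measure_ne_top _ _)) (measureReal_biUnion_finset_le _ _)
    rintro ω ⟨q, hq, h⟩
    exact Set.mem_biUnion hq h.le
  | succ m ih =>
    have hsub : {ω | ∃ q ∈ unitGrid (k (m + 1)),
          v + ∑ n ∈ Finset.range (m + 1), s n < |Y q ω|} ⊆
        {ω | ∃ q ∈ unitGrid (k m), v + ∑ n ∈ Finset.range m, s n < |Y q ω|} ∪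
        ⋃ q ∈ unitGrid (k (m + 1)), {ω | s m ≤ |Y q ω - Y (gridFloor (k m) q) ω|} := by
      rintro ω ⟨q, hq, h⟩
      rw [Finset.sum_range_succ] at h
      -- Either the link from `q` to its cell corner is long, or that corner on the coarser grid
      -- already exceeds the level lowered by `s m`.
      by_cases hc : s m ≤ |Y q ω - Y (gridFloor (k m) q) ω|
      · exact Or.inr (Set.mem_biUnion hq hc)
      · left
        obtain ⟨h1, h2⟩ := le_one_of_mem_unitGrid hq
        refine ⟨_, gridFloor_mem_unitGrid _ h1 h2, ?_⟩
        have := abs_sub_abs_le_abs_sub (Y q ω) (Y (gridFloor (k m) q) ω)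
        linarith
    calc _ ≤ _ := measureReal_mono hsub
      _ ≤ _ := measureReal_union_le _ _
      _ ≤ _ := add_le_add ih (measureReal_biUnion_finset_le _ _)
      _ = _ := by rw [Finset.sum_range_succ, add_assoc]

/-! ### Tail of the maximum over the unit square -/

/-- For small `u` the tail bound is trivial, so chaining is needed only for `u > 5`. As `H < 1`, the
claim reduces to `exp(3u²/8) ≤ 8 e^(5/2) u^4`, checked on `[2,4]` and `[4,5]`. -/
theorem one_le_supBound_of_le_five {H u : ℝ} (hH : 0 < H) (hH1 : H < 1) (hu : 2 ≤ u)
    (hu5 : u ≤ 5) :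
    1 ≤ 8 * Real.exp (2 / H + 1 / 2) * u ^ (4 / H) * Real.exp (-(3 / 8 * u ^ 2)) := by
  have h2 : (2 : ℝ) ≤ 2 / H := by rw [le_div_iff₀ hH]; nlinarith
  have h4 : (4 : ℝ) ≤ 4 / H := by rw [le_div_iff₀ hH]; nlinarith
  have hpow : u ^ 4 ≤ u ^ (4 / H) := by
    rw [← Real.rpow_natCast]
    exact Real.rpow_le_rpow_of_exponent_le (by linarith) (by exact_mod_cast h4)
  have hexp : Real.exp (5 / 2) ≤ Real.exp (2 / H + 1 / 2) := Real.exp_le_exp.2 (by linarith)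
  have hnum : Real.exp (3 / 8 * u ^ 2) ≤ Real.exp (5 / 2) * (8 * u ^ 4) := by
    have he : ∀ n : ℕ, Real.exp n ≤ 2.7182818286 ^ n := fun n => by
      rw [← mul_one (n : ℝ), Real.exp_nat_mul]
      gcongr
      exact Real.exp_one_lt_d9.le
    rcases le_total u 4 with h | h
    · have h16 : (16 : ℝ) ≤ u ^ 4 := by
        calc (16 : ℝ) = 2 ^ 4 := by norm_num
          _ ≤ u ^ 4 := by gcongr
      calc Real.exp (3 / 8 * u ^ 2) ≤ Real.exp (5 / 2 + (4 : ℕ)) :=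
            Real.exp_le_exp.2 (by push_cast; nlinarith)
        _ = Real.exp (5 / 2) * Real.exp (4 : ℕ) := Real.exp_add _ _
        _ ≤ _ := by
            gcongr
            refine (he 4).trans ?_
            norm_num
            linarith
    · have h256 : (256 : ℝ) ≤ u ^ 4 := by
        calc (256 : ℝ) = 4 ^ 4 := by norm_num
          _ ≤ u ^ 4 := by gcongr
      calc Real.exp (3 / 8 * u ^ 2) ≤ Real.exp (5 / 2 + (7 : ℕ)) :=
            Real.exp_le_exp.2 (by push_cast; nlinarith)
        _ = Real.exp (5 / 2) * Real.exp (7 : ℕ) := Real.exp_add _ _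
        _ ≤ _ := by
            gcongr
            refine (he 7).trans ?_
            norm_num
            linarith
  calc (1 : ℝ) = Real.exp (3 / 8 * u ^ 2) * Real.exp (-(3 / 8 * u ^ 2)) := by
        rw [← Real.exp_add]; simp
    _ ≤ Real.exp (5 / 2) * (8 * u ^ 4) * Real.exp (-(3 / 8 * u ^ 2)) := by gcongr
    _ = 8 * Real.exp (5 / 2) * u ^ 4 * Real.exp (-(3 / 8 * u ^ 2)) := by ring
    _ ≤ _ := by gcongr

/-- With `x = a^(1/H) ≥ a ≥ 20`, rounding costs at most 2, and `x + 2 ≤ 1.1 x`. -/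
theorem ceil_rpow_add_one_sq_le {H a : ℝ} (hH : 0 < H) (hH1 : H < 1) (ha : 20 ≤ a) :
    ((⌈a ^ (1 / H)⌉₊ : ℝ) + 1) ^ 2 ≤ 1.21 * a ^ (2 / H) := by
  have h1 : a ≤ a ^ (1 / H) := by
    conv_lhs => rw [← Real.rpow_one a]
    exact Real.rpow_le_rpow_of_exponent_le (by linarith) (by rw [le_div_iff₀ hH]; linarith)
  have h2 := (Nat.ceil_lt_add_one (a := a ^ (1 / H)) (by positivity)).le
  have h3 : a ^ (2 / H) = (a ^ (1 / H)) ^ 2 := by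
    rw [← Real.rpow_natCast, ← Real.rpow_mul (by linarith)]
    congr 1
    push_cast
    ring
  rw [h3]
  calc ((⌈a ^ (1 / H)⌉₊ : ℝ) + 1) ^ 2 ≤ (1.1 * a ^ (1 / H)) ^ 2 := by
        gcongr
        linarith
    _ = _ := by ring

theorem le_ceil_rpow_rpow {H a : ℝ} (hH : 0 < H) (ha : 0 < a) : a ≤ (⌈a ^ (1 / H)⌉₊ : ℝ) ^ H := by
  calc a = (a ^ (1 / H)) ^ H := by
        rw [← Real.rpow_mul ha.le, one_div, inv_mul_cancel₀ hH.ne', Real.rpow_one]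
    _ ≤ _ := by
        gcongr
        exact Nat.le_ceil _

/-- Tail bound for the maximum over a finite subset of the unit square of a field with Gaussian
tails whose increments are Hölder of order `H`. -/
theorem measureReal_exists_mem_finset_le {Ω : Type*} [MeasurableSpace Ω] {P : Measure Ω}
    [IsProbabilityMeasure P] {Y : ℝ≥0 × ℝ≥0 → Ω → ℝ} {H : ℝ} (hH : 0 < H) (hH1 : H < 1)
    (h0 : ∀ t : ℝ≥0 × ℝ≥0, t.1 ≤ 1 → t.2 ≤ 1 → ∀ v : ℝ, 0 ≤ v →
      P.real {ω | v ≤ |Y t ω|} ≤ 2 * Real.exp (-v ^ 2 / 2))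
    (h1 : ∀ s t : ℝ≥0 × ℝ≥0, s.1 ≤ 1 → s.2 ≤ 1 → t.1 ≤ 1 → t.2 ≤ 1 → ∀ δ : ℝ, 0 < δ → δ ≤ 1 →
      |(t.1 : ℝ) - s.1| ≤ δ → |(t.2 : ℝ) - s.2| ≤ δ → ∀ v : ℝ, 0 ≤ v →
      P.real {ω | v ≤ |Y t ω - Y s ω|} ≤ 2 * Real.exp (-v ^ 2 / (8 * (δ ^ H) ^ 2)))
    {u : ℝ} (hu : 2 ≤ u) (F : Finset (ℝ≥0 × ℝ≥0)) (hF : ∀ t ∈ F, t.1 ≤ 1 ∧ t.2 ≤ 1) :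
    P.real {ω | ∃ t ∈ F, 49 / 50 * u < |Y t ω|} ≤
      8 * Real.exp (2 / H + 1 / 2) * u ^ (4 / H) * Real.exp (-(3 / 8 * u ^ 2)) := by
  set R := 8 * Real.exp (2 / H + 1 / 2) * u ^ (4 / H) * Real.exp (-(3 / 8 * u ^ 2)) with hR
  -- Beyond `u > 5`, the remaining case `R < 1` gives `K * e ≤ 1`, which controls the growth of the
  -- grids uniformly in `H`.
  rcases le_or_gt 1 R with hR1 | hR1
  · exact measureReal_le_one.trans hR1
  have hu5 : 5 < u := by
    by_contra hcon
    exact absurd (one_le_supBound_of_le_five hH hH1 hu (not_lt.1 hcon)) (not_le.2 hR1)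
  have hu0 : 0 < u := by linarith
  set e := Real.exp (-(3 / 8 * u ^ 2)) with he
  set K := Real.exp (2 / H) * u ^ (4 / H) with hK
  have hK0 : 0 < K := by positivity
  have he0 : 0 < e := Real.exp_pos _
  have hRK : 8 * (K * e) ≤ R := by
    have : R = 8 * (K * e) * Real.exp (1 / 2) := by rw [hR, Real.exp_add, hK]; ring
    rw [this]
    exact le_mul_of_one_le_right (by positivity) (Real.one_le_exp (by norm_num))
  set L := (4 : ℝ) ^ (2 / H) with hL
  have hL0 : 0 < L := by positivity
  -- `L` is the growth factor of the grid cardinalities. As `u ≥ 4`, `L² = 4^(4/H) ≤ K ≤ 1/e`, a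
  -- bound free of `H`.
  have hLexp : L ≤ Real.exp (3 / 16 * u ^ 2) := by
    have hLK : L ^ 2 ≤ K := by
      calc L ^ 2 = 1 * 4 ^ (4 / H) := by
            rw [hL, one_mul, ← Real.rpow_natCast, ← Real.rpow_mul (by norm_num)]
            congr 1
            push_cast
            ring
        _ ≤ K := by
            rw [hK]
            gcongr
            · exact Real.one_le_exp (by positivity)
            · linarith
    have hKe : K * e ≤ 1 := by linarith [mul_pos hK0 he0]
    have : L ^ 2 ≤ Real.exp (3 / 16 * u ^ 2) ^ 2 := by
      calc L ^ 2 ≤ K := hLK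
        _ = K * e * Real.exp (3 / 8 * u ^ 2) := by
            rw [he, mul_assoc, ← Real.exp_add]; simp
        _ ≤ 1 * Real.exp (3 / 8 * u ^ 2) := by gcongr
        _ = _ := by rw [one_mul, ← Real.exp_nat_mul]; congr 1; push_cast; ring
    exact (sq_le_sq₀ hL0.le (Real.exp_pos _).le).1 this
  -- The mesh satisfies `(1 / k n)^H ≤ 1 / a n`, and `a 0 ^ (2/H)` is exactly the prefactor `K`.
  set a : ℕ → ℝ := fun n => Real.exp 1 * u ^ 2 * 4 ^ n with ha
  set k : ℕ → ℕ := fun n => ⌈a n ^ (1 / H)⌉₊ with hk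
  have hexp1 : (2.7 : ℝ) ≤ Real.exp 1 := by linarith [Real.exp_one_gt_d9]
  have ha50 : ∀ n, 50 ≤ a n := fun n => by
    have h4 : (1 : ℝ) ≤ 4 ^ n := one_le_pow₀ (by norm_num)
    calc (50 : ℝ) ≤ 2.7 * 5 ^ 2 * 1 := by norm_num
      _ ≤ a n := by rw [ha]; dsimp only; gcongr
  have ha0 : ∀ n, 0 < a n := fun n => by linarith [ha50 n]
  have haK : ∀ n, a n ^ (2 / H) = K * L ^ n := fun n => by
    rw [ha, hK, hL]
    dsimp only
    rw [Real.mul_rpow (by positivity) (by positivity), Real.mul_rpow (by positivity) (by positivity),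
      ← Real.exp_mul, one_mul]
    congr 1
    · congr 1
      rw [← Real.rpow_natCast u 2, ← Real.rpow_mul hu0.le]
      congr 1
      push_cast
      ring
    · rw [← Real.rpow_natCast, ← Real.rpow_natCast, ← Real.rpow_mul (by norm_num),
        ← Real.rpow_mul (by norm_num), mul_comm]
  have hcard : ∀ n, ((unitGrid (k n)).card : ℝ) ≤ 1.21 * (K * L ^ n) := fun n => by
    rw [← haK]
    exact (card_unitGrid_le _).trans (ceil_rpow_add_one_sq_le hH hH1 (by linarith [ha50 n]))
  have hkpos : ∀ n, 0 < k n := fun n => Nat.ceil_pos.2 (Real.rpow_pos_of_pos (ha0 n) _)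
  have hinc : ∀ n, ∀ t : ℝ≥0 × ℝ≥0, t.1 ≤ 1 → t.2 ≤ 1 → ∀ v : ℝ, 0 ≤ v →
      P.real {ω | v ≤ |Y t ω - Y (gridFloor (k n) t) ω|} ≤
        2 * Real.exp (-(v ^ 2 * a n ^ 2 / 8)) := by
    intro n t ht1 ht2 v hv
    have hkn : (1 : ℝ) ≤ k n := by exact_mod_cast hkpos n
    obtain ⟨hg1, hg2⟩ := le_one_of_mem_unitGrid (gridFloor_mem_unitGrid (k n) ht1 ht2)
    refine (h1 (gridFloor (k n) t) t hg1 hg2 ht1 ht2 (1 / k n) (by positivity)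
      (by rw [div_le_one (by positivity)]; exact hkn) (abs_sub_floor_div_le (hkpos n) _)
      (abs_sub_floor_div_le (hkpos n) _) v hv).trans ?_
    gcongr 2 * Real.exp ?_
    have hc : a n ≤ (k n : ℝ) ^ H := le_ceil_rpow_rpow hH (ha0 n)
    have e1 : ((1 / (k n : ℝ)) ^ H) ^ 2 = 1 / (((k n : ℝ) ^ H) ^ 2) := by
      rw [Real.div_rpow (by norm_num) (by positivity), Real.one_rpow, div_pow, one_pow]
    rw [e1]
    have e2 : -v ^ 2 / (8 * (1 / (((k n : ℝ) ^ H) ^ 2))) = -(v ^ 2 * ((k n : ℝ) ^ H) ^ 2 / 8) := by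
      field_simp
    rw [e2]
    have := ha0 n
    gcongr
  -- The level `49/50 · u` is shared as `0.87 + 0.1 + 0.01 = 0.98`: coarsest grid, chaining links,
  -- and last link to a point of `F`.
  set s : ℕ → ℝ := fun n => u / 20 * (1 / 2) ^ n with hs
  have hs0 : ∀ n, 0 ≤ s n := fun n => by rw [hs]; positivity
  have hssum : ∀ m, ∑ n ∈ Finset.range m, s n ≤ u / 10 := fun m => by
    rw [hs, ← Finset.mul_sum]
    have := Summable.sum_le_tsum (Finset.range m) (fun n _ => by positivity)
      summable_geometric_two
    rw [tsum_geometric_two] at this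
    nlinarith
  have hterm : ∀ n, ∑ q ∈ unitGrid (k (n + 1)),
      P.real {ω | s n ≤ |Y q ω - Y (gridFloor (k n) q) ω|} ≤
        1.21 * K * e * (1 / 2) ^ n := by
    intro n
    have hexpo : L ^ (n + 1) * (2 * Real.exp (-(s n ^ 2 * a n ^ 2 / 8))) ≤ e * (1 / 2) ^ n := by
      -- The links shrink like `2^(-n)` while the mesh scale grows like `4^n`, so the exponent grows
      -- like `4^n ≥ n + 1` and outweighs the cardinality factor `L^(n+1)`.
      have hE : 1.36 * u ^ 2 * (n + 1) ≤ s n ^ 2 * a n ^ 2 / 8 := by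
        have e1 : s n ^ 2 * a n ^ 2 / 8 = u ^ 2 * (Real.exp 1 ^ 2 * u ^ 4 / 3200 * 4 ^ n) := by
          rw [hs, ha]
          dsimp only
          have : ((1 / 2 : ℝ) ^ n) ^ 2 * (4 ^ n) ^ 2 = 4 ^ n := by
            rw [← pow_mul, mul_comm n 2, pow_mul, sq ((4 : ℝ) ^ n), ← mul_assoc, ← mul_pow]
            norm_num
          linear_combination (u ^ 6 * Real.exp 1 ^ 2 / 3200) * this
        have e2 : (n : ℝ) + 1 ≤ 4 ^ n := by
          have := one_add_mul_le_pow (a := (3 : ℝ)) (by norm_num) n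
          norm_num at this
          have hn : (0 : ℝ) ≤ n := n.cast_nonneg
          linarith
        have e3 : (1.36 : ℝ) ≤ Real.exp 1 ^ 2 * u ^ 4 / 3200 := by
          calc (1.36 : ℝ) ≤ 2.7 ^ 2 * 5 ^ 4 / 3200 := by norm_num
            _ ≤ _ := by gcongr
        rw [e1, mul_comm 1.36, mul_assoc]
        gcongr
      have hn : (0 : ℝ) ≤ n := n.cast_nonneg
      calc L ^ (n + 1) * (2 * Real.exp (-(s n ^ 2 * a n ^ 2 / 8)))
          ≤ Real.exp (3 / 16 * u ^ 2) ^ (n + 1) *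
            (2 * Real.exp (-(1.36 * u ^ 2 * (n + 1)))) := by gcongr
        _ = 2 ^ (n + 1) * Real.exp (3 / 16 * u ^ 2 * (n + 1) - 1.36 * u ^ 2 * (n + 1))
              * (1 / 2) ^ n := by
            have e1 : Real.exp (3 / 16 * u ^ 2) ^ (n + 1) =
                Real.exp (3 / 16 * u ^ 2 * (n + 1)) := by
              rw [← Real.exp_nat_mul, mul_comm]
              push_cast
              rfl
            have e2 : (2 : ℝ) ^ (n + 1) * (1 / 2) ^ n = 2 := by
              rw [pow_succ, mul_right_comm, ← mul_pow]
              norm_num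
            rw [e1, sub_eq_add_neg, Real.exp_add]
            linear_combination -(Real.exp (3 / 16 * u ^ 2 * (n + 1)) *
              Real.exp (-(1.36 * u ^ 2 * (n + 1)))) * e2
        _ ≤ Real.exp 1 ^ (n + 1) * Real.exp (3 / 16 * u ^ 2 * (n + 1) - 1.36 * u ^ 2 * (n + 1))
              * (1 / 2) ^ n := by
            gcongr
            linarith
        _ ≤ e * (1 / 2) ^ n := by
            rw [← Real.exp_nat_mul, ← Real.exp_add, he]
            gcongr
            push_cast
            have hu25 : 25 ≤ u ^ 2 := by nlinarith
            nlinarith [mul_nonneg hn (sub_nonneg.2 hu25)]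
    calc ∑ q ∈ unitGrid (k (n + 1)), P.real {ω | s n ≤ |Y q ω - Y (gridFloor (k n) q) ω|}
        ≤ ∑ q ∈ unitGrid (k (n + 1)), 2 * Real.exp (-(s n ^ 2 * a n ^ 2 / 8)) := by
          apply Finset.sum_le_sum
          intro q hq
          obtain ⟨hq1, hq2⟩ := le_one_of_mem_unitGrid hq
          exact hinc n q hq1 hq2 _ (hs0 n)
      _ = (unitGrid (k (n + 1))).card * (2 * Real.exp (-(s n ^ 2 * a n ^ 2 / 8))) := by
          rw [Finset.sum_const, nsmul_eq_mul]
      _ ≤ 1.21 * (K * L ^ (n + 1)) * (2 * Real.exp (-(s n ^ 2 * a n ^ 2 / 8))) := by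
          gcongr
          exact hcard _
      _ = 1.21 * K * (L ^ (n + 1) * (2 * Real.exp (-(s n ^ 2 * a n ^ 2 / 8)))) := by ring
      _ ≤ 1.21 * K * (e * (1 / 2) ^ n) := by gcongr
      _ = _ := by ring
  have hfirst : ∑ q ∈ unitGrid (k 0), P.real {ω | 0.87 * u ≤ |Y q ω|} ≤ 2.42 * K * e := by
    calc ∑ q ∈ unitGrid (k 0), P.real {ω | 0.87 * u ≤ |Y q ω|}
        ≤ ∑ q ∈ unitGrid (k 0), 2 * e := by
          apply Finset.sum_le_sum
          intro q hq
          obtain ⟨hq1, hq2⟩ := le_one_of_mem_unitGrid hq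
          refine (h0 q hq1 hq2 _ (by positivity)).trans ?_
          rw [he]
          gcongr 2 * Real.exp ?_
          -- `0.87² / 2 = 0.37845` just exceeds 3/8.
          nlinarith
      _ = (unitGrid (k 0)).card * (2 * e) := by rw [Finset.sum_const, nsmul_eq_mul]
      _ ≤ 1.21 * (K * L ^ 0) * (2 * e) := by
          gcongr
          exact hcard _
      _ = _ := by rw [pow_zero]; ring
  have hfin : ∀ m, P.real {ω | ∃ t ∈ F, 49 / 50 * u < |Y t ω|} ≤
      4.84 * K * e + F.card * (2 * Real.exp (-((u / 100) ^ 2 * a m ^ 2 / 8))) := by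
    intro m
    have hsub : {ω | ∃ t ∈ F, 49 / 50 * u < |Y t ω|} ⊆
        {ω | ∃ q ∈ unitGrid (k m), 0.87 * u + ∑ n ∈ Finset.range m, s n < |Y q ω|} ∪
        ⋃ t ∈ F, {ω | u / 100 ≤ |Y t ω - Y (gridFloor (k m) t) ω|} := by
      rintro ω ⟨t, ht, h⟩
      by_cases hc : u / 100 ≤ |Y t ω - Y (gridFloor (k m) t) ω|
      · exact Or.inr (Set.mem_biUnion ht hc)
      · left
        obtain ⟨ht1, ht2⟩ := hF t ht
        refine ⟨_, gridFloor_mem_unitGrid _ ht1 ht2, ?_⟩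
        have := abs_sub_abs_le_abs_sub (Y t ω) (Y (gridFloor (k m) t) ω)
        linarith [hssum m]
    have hlast : ∑ t ∈ F, P.real {ω | u / 100 ≤ |Y t ω - Y (gridFloor (k m) t) ω|} ≤
        F.card * (2 * Real.exp (-((u / 100) ^ 2 * a m ^ 2 / 8))) := by
      rw [← nsmul_eq_mul, ← Finset.sum_const]
      exact Finset.sum_le_sum fun t ht => hinc m t (hF t ht).1 (hF t ht).2 _ (by positivity)
    have hmid : ∑ n ∈ Finset.range m, ∑ q ∈ unitGrid (k (n + 1)),
        P.real {ω | s n ≤ |Y q ω - Y (gridFloor (k n) q) ω|} ≤ 2.42 * K * e := by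
      calc _ ≤ ∑ n ∈ Finset.range m, 1.21 * K * e * (1 / 2) ^ n :=
            Finset.sum_le_sum fun n _ => hterm n
        _ = 1.21 * K * e * ∑ n ∈ Finset.range m, (1 / 2 : ℝ) ^ n := by rw [Finset.mul_sum]
        _ ≤ 1.21 * K * e * 2 := by
            gcongr
            exact (Summable.sum_le_tsum _ (fun n _ => by positivity)
              summable_geometric_two).trans_eq tsum_geometric_two
        _ = _ := by ring
    calc _ ≤ _ := measureReal_mono hsub
      _ ≤ _ := measureReal_union_le _ _
      _ ≤ (2.42 * K * e + 2.42 * K * e) +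
          F.card * (2 * Real.exp (-((u / 100) ^ 2 * a m ^ 2 / 8))) := by
          refine add_le_add ((measureReal_exists_unitGrid_le k _ s m).trans
            (add_le_add hfirst hmid)) ((measureReal_biUnion_finset_le _ _).trans hlast)
      _ = _ := by ring
  -- `F` is fixed while the grids refine, so the cost of the last link vanishes; what remains is
  -- `4.84 K e ≤ 8 K e ≤ R`.
  have hlim : Tendsto (fun m => 4.84 * K * e +
      F.card * (2 * Real.exp (-((u / 100) ^ 2 * a m ^ 2 / 8)))) atTop
      (𝓝 (4.84 * K * e + F.card * (2 * 0))) := by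
    refine ((Tendsto.const_mul _ (Tendsto.const_mul _ ?_))).const_add _
    refine Real.tendsto_exp_neg_atTop_nhds_zero.comp ?_
    have hat : Tendsto a atTop atTop :=
      (tendsto_pow_atTop_atTop_of_one_lt (by norm_num)).const_mul_atTop (by positivity)
    have := ((tendsto_pow_atTop (two_ne_zero)).comp hat).const_mul_atTop
      (show 0 < (u / 100) ^ 2 / 8 by positivity)
    refine this.congr fun m => ?_
    simp only [Function.comp_apply]
    ring
  have := ge_of_tendsto' hlim hfin
  nlinarith [mul_pos hK0 he0]

/-! ### Convergence and decay of the series -/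

theorem rpow_le_mul_exp {p d x : ℝ} (hp : 0 < p) (hd : 0 < d) (hx : 0 ≤ x) :
    x ^ p ≤ (p / d) ^ p * Real.exp (d * x) := by
  have h : x ≤ p / d * Real.exp (d * x / p) := by
    have h1 := Real.add_one_le_exp (d * x / p)
    calc x = p / d * (d * x / p) := by field_simp
      _ ≤ _ := by gcongr; linarith
  calc x ^ p ≤ (p / d * Real.exp (d * x / p)) ^ p := by gcongr
    _ = _ := by
      rw [Real.mul_rpow (by positivity) (Real.exp_pos _).le, ← Real.exp_mul]
      congr 2
      field_simp

/-- From `m² ≥ M m` the Gaussian factor is at most `exp(-aMm)`; half of this exponent absorbs the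
power, the other half is summable by hypothesis. -/
theorem summable_exp_neg_sq_mul_rpow {m : ℕ → ℝ} {M a p : ℝ} (hM : 0 < M) (hm : ∀ k, M ≤ m k)
    (ha : 0 < a) (hp : 0 < p)
    (hseries : ∀ D : ℝ, 0 < D → Summable (fun k : ℕ => Real.exp (-(D * m (k + 1))))) :
    Summable (fun k => Real.exp (-a * m k ^ 2) * m k ^ p) := by
  have hm0 : ∀ k, 0 < m k := fun k => hM.trans_le (hm k)
  rw [← summable_nat_add_iff 1]
  have hd : 0 < a * M / 2 := by positivity
  refine Summable.of_nonneg_of_le (fun k => ?_) (fun k => ?_)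
    ((hseries (a * M / 2) hd).mul_left ((p / (a * M / 2)) ^ p))
  · have := hm0 (k + 1)
    positivity
  · have h := hm0 (k + 1)
    calc Real.exp (-a * m (k + 1) ^ 2) * m (k + 1) ^ p
        ≤ Real.exp (-(a * M * m (k + 1))) *
          ((p / (a * M / 2)) ^ p * Real.exp (a * M / 2 * m (k + 1))) := by
          gcongr
          · nlinarith [mul_le_mul_of_nonneg_left (hm (k + 1)) (mul_pos ha h).le]
          · exact rpow_le_mul_exp hp hd h.le
      _ = _ := by
          rw [mul_left_comm, ← Real.exp_add]
          congr 2
          ring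

section Levels

variable {H₁ H₂ : ℝ} {c : ℝ → ℝ} {b : ℕ → ℝ}

theorem ZtildeTerm_eq (ε : ℝ) (k : ℕ) :
    ZtildeTerm H₁ H₂ c b ε k =
      Real.exp (-(3 / (2 * ((4 : ℝ) ^ (1 - min H₁ H₂) + 3)) * ε ^ 2) * levelRatio H₁ H₂ c b k ^ 2) *
        levelRatio H₁ H₂ c b k ^ (4 / min H₁ H₂) := by
  rw [ZtildeTerm]
  congr 3
  ring

theorem summable_ZtildeTerm {M ε : ℝ} (hH : 0 < min H₁ H₂) (hM : 0 < M)
    (hm : ∀ k, M ≤ levelRatio H₁ H₂ c b k)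
    (hseries : ∀ D : ℝ, 0 < D →
      Summable (fun k : ℕ => Real.exp (-(D * levelRatio H₁ H₂ c b (k + 1))))) (hε : 0 < ε) :
    Summable (ZtildeTerm H₁ H₂ c b ε) := by
  rw [funext (ZtildeTerm_eq (H₁ := H₁) (H₂ := H₂) (c := c) (b := b) ε)]
  exact summable_exp_neg_sq_mul_rpow hM hm (by positivity) (by positivity) hseries

/-- Used for the almost sure finiteness of the supremum. For `ε ≥ 1`, half of the exponent keeps the
series summable and the other half yields `exp(-aM²ε/2)`, which beats `ε^p`. -/
theorem tendsto_Ztilde_atTop {M : ℝ} (hH : 0 < min H₁ H₂) (hM : 0 < M)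
    (hm : ∀ k, M ≤ levelRatio H₁ H₂ c b k)
    (hseries : ∀ D : ℝ, 0 < D →
      Summable (fun k : ℕ => Real.exp (-(D * levelRatio H₁ H₂ c b (k + 1))))) :
    Tendsto (Ztilde H₁ H₂ c b) atTop (𝓝 0) := by
  set a := 3 / (2 * ((4 : ℝ) ^ (1 - min H₁ H₂) + 3)) with ha
  have ha0 : 0 < a := by positivity
  set p := 4 / min H₁ H₂ with hp
  have hp0 : 0 < p := by positivity
  set A := 16 * Real.exp (2 / min H₁ H₂ + 1 / 2) with hA
  have hsum := summable_exp_neg_sq_mul_rpow hM hm (half_pos ha0) hp0 hseries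
  have hm0 : ∀ k, 0 < levelRatio H₁ H₂ c b k := fun k => hM.trans_le (hm k)
  set C := ∑' k, Real.exp (-(a / 2) * levelRatio H₁ H₂ c b k ^ 2) * levelRatio H₁ H₂ c b k ^ p
  have hC : 0 ≤ C := tsum_nonneg fun k => by
    have := hm0 k
    positivity
  have hlim : Tendsto (fun ε : ℝ => A * C * (ε ^ p * Real.exp (-(a * M ^ 2 / 2) * ε))) atTop
      (𝓝 (A * C * 0)) :=
    (tendsto_rpow_mul_exp_neg_mul_atTop_nhds_zero p _ (by positivity)).const_mul _
  rw [mul_zero] at hlim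
  refine squeeze_zero' ?_ ?_ hlim
  · filter_upwards [eventually_ge_atTop 1] with ε hε
    refine mul_nonneg (by positivity) (tsum_nonneg fun k => ?_)
    have := hm0 k
    rw [ZtildeTerm]
    positivity
  · filter_upwards [eventually_ge_atTop 1] with ε hε
    have hterm : ∀ k, ZtildeTerm H₁ H₂ c b ε k ≤ Real.exp (-(a * M ^ 2 / 2) * ε) *
        (Real.exp (-(a / 2) * levelRatio H₁ H₂ c b k ^ 2) * levelRatio H₁ H₂ c b k ^ p) := by
      intro k
      have h := hm0 k
      rw [ZtildeTerm_eq, ← mul_assoc, ← Real.exp_add]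
      gcongr
      have h1 : M ^ 2 ≤ levelRatio H₁ H₂ c b k ^ 2 := by
        have := hm k
        gcongr
      have h2 : ε ≤ ε ^ 2 := by nlinarith
      have h3 : M ^ 2 * ε ≤ levelRatio H₁ H₂ c b k ^ 2 * ε ^ 2 := by gcongr
      have h4 : levelRatio H₁ H₂ c b k ^ 2 * 1 ≤ levelRatio H₁ H₂ c b k ^ 2 * ε ^ 2 := by
        gcongr
        linarith
      nlinarith [mul_le_mul_of_nonneg_left h3 ha0.le, mul_le_mul_of_nonneg_left h4 ha0.le]
    calc Ztilde H₁ H₂ c b ε = A * ε ^ p * ∑' k, ZtildeTerm H₁ H₂ c b ε k := rfl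
      _ ≤ A * ε ^ p * (Real.exp (-(a * M ^ 2 / 2) * ε) * C) := by
          gcongr
          rw [← tsum_mul_left]
          exact (summable_ZtildeTerm hH hM hm hseries (by linarith)).tsum_le_tsum hterm
            (hsum.mul_left _)
      _ = _ := by ring

theorem supBound_le_ZtildeTerm {ε : ℝ} (hH1 : min H₁ H₂ < 1) (hε : 0 < ε) {k : ℕ}
    (hm : 0 < levelRatio H₁ H₂ c b k) :
    8 * Real.exp (2 / min H₁ H₂ + 1 / 2) * (ε * levelRatio H₁ H₂ c b k) ^ (4 / min H₁ H₂) *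
        Real.exp (-(3 / 8 * (ε * levelRatio H₁ H₂ c b k) ^ 2)) ≤
      8 * Real.exp (2 / min H₁ H₂ + 1 / 2) * ε ^ (4 / min H₁ H₂) * ZtildeTerm H₁ H₂ c b ε k := by
  have h4 : (1 : ℝ) ≤ 4 ^ (1 - min H₁ H₂) := Real.one_le_rpow (by norm_num) (by linarith)
  have ha : 3 / (2 * ((4 : ℝ) ^ (1 - min H₁ H₂) + 3)) ≤ 3 / 8 := by
    gcongr
    linarith
  rw [ZtildeTerm_eq, Real.mul_rpow hε.le hm.le]
  have he : Real.exp (-(3 / 8 * (ε * levelRatio H₁ H₂ c b k) ^ 2)) ≤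
      Real.exp (-(3 / (2 * ((4 : ℝ) ^ (1 - min H₁ H₂) + 3)) * ε ^ 2) *
        levelRatio H₁ H₂ c b k ^ 2) := by
    apply Real.exp_le_exp.2
    have := mul_le_mul_of_nonneg_right ha (sq_nonneg (ε * levelRatio H₁ H₂ c b k))
    nlinarith
  calc _ ≤ _ := mul_le_mul_of_nonneg_left he (by positivity)
    _ = _ := by ring

/-! ### Decomposition of the quadrant into shells -/

/-- The side of the square attached to the index `(k, i)`. -/
noncomputable def levelSide (b : ℕ → ℝ) (i : ℕ × Bool) : ℝ := if i.2 then b (i.1 + 1) else 1 / b i.1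

/-- A lower bound of the weight on the shell attached to the index `(k, i)`. -/
noncomputable def levelWeight (H₁ H₂ : ℝ) (c : ℝ → ℝ) (b : ℕ → ℝ) (i : ℕ × Bool) : ℝ :=
  levelSide b i ^ (H₁ + H₂) * levelRatio H₁ H₂ c b i.1

theorem levelSide_pos (hb : ∀ k, 0 < b k) (i : ℕ × Bool) : 0 < levelSide b i := by
  have h1 := hb (i.1 + 1)
  have h2 := hb i.1
  unfold levelSide
  split_ifs <;> positivity

theorem exists_not_and_succ {p : ℕ → Prop} (h0 : ¬p 0) (h : ∃ n, p n) :
    ∃ k, ¬p k ∧ p (k + 1) := by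
  by_contra! hcon
  obtain ⟨n, hn⟩ := h
  exact Nat.rec (motive := fun n => ¬p n) h0 hcon n hn

/-- With `r = t₁ ∨ t₂`, the inner radius of a shell is its outer radius times `b_k / b_(k+1)`, and
`c r ≥ c (b_k)` on both families since `c r = c (1/r)`. The strict inequalities put `t` in an open
square, as separability requires. -/
theorem exists_levelWeight_le_fieldWeight (hH : 0 < H₁ + H₂) (hcpos : ∀ t, 0 < t → 0 < c t)
    (hcmono : MonotoneOn c (Set.Ici 1)) (hcinv : ∀ t, 1 ≤ t → c (1 / t) = c t) (hb0 : b 0 = 1)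
    (hbmono : StrictMono b) (hbtop : Tendsto b atTop atTop) {t : ℝ≥0 × ℝ≥0} (ht : t ≠ 0) :
    ∃ i : ℕ × Bool, (t.1 : ℝ) < levelSide b i ∧ (t.2 : ℝ) < levelSide b i ∧
      levelWeight H₁ H₂ c b i ≤ fieldWeight H₁ H₂ c t := by
  have hb1 : ∀ k, 1 ≤ b k := fun k => hb0 ▸ hbmono.monotone (Nat.zero_le k)
  have hbpos : ∀ k, 0 < b k := fun k => one_pos.trans_le (hb1 k)
  set r : ℝ := ((max t.1 t.2 : ℝ≥0) : ℝ) with hr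
  have hr0 : 0 < r := by
    rw [hr, NNReal.coe_pos, lt_max_iff]
    by_contra hcon
    push Not at hcon
    exact ht (Prod.ext (le_zero_iff.1 hcon.1) (le_zero_iff.1 hcon.2))
  have hr1 : (t.1 : ℝ) ≤ r := NNReal.coe_le_coe.2 (le_max_left _ _)
  have hr2 : (t.2 : ℝ) ≤ r := NNReal.coe_le_coe.2 (le_max_right _ _)
  have hfw : fieldWeight H₁ H₂ c t = r ^ (H₁ + H₂) * c r := rfl
  rcases le_or_gt 1 r with h1 | h1
  · obtain ⟨k, hk1, hk2⟩ := exists_not_and_succ (p := fun n => r < b n)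
      (not_lt.2 (hb0.trans_le h1)) (hbtop.eventually_gt_atTop r).exists
    rw [not_lt] at hk1
    refine ⟨(k, true), hr1.trans_lt hk2, hr2.trans_lt hk2, ?_⟩
    have hp := hbpos k
    have hp' := hbpos (k + 1)
    have hc0 := hcpos (b k) hp
    rw [hfw, levelWeight, levelRatio, ← mul_assoc]
    simp only [levelSide, if_true]
    rw [← Real.mul_rpow hp'.le (by positivity), mul_div_cancel₀ _ hp'.ne']
    gcongr
    exact hcmono (hb1 k) h1 hk1
  · have hinv : 1 ≤ r⁻¹ := (one_le_inv₀ hr0).2 h1.le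
    have hinv' : b 0 < r⁻¹ := by rw [hb0]; exact (one_lt_inv₀ hr0).2 h1
    obtain ⟨k, hk1, hk2⟩ := exists_not_and_succ (p := fun n => r⁻¹ ≤ b n) (not_le.2 hinv')
      (hbtop.eventually_ge_atTop r⁻¹).exists
    rw [not_le] at hk1
    have hp := hbpos k
    have hp' := hbpos (k + 1)
    have hlt : r < 1 / b k := by
      rw [one_div]
      exact (lt_inv_comm₀ hp hr0).1 hk1
    refine ⟨(k, false), hr1.trans_lt hlt, hr2.trans_lt hlt, ?_⟩
    have hc0 := hcpos (b k) hp
    have hcr : c r = c r⁻¹ := by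
      have := hcinv r⁻¹ hinv
      rwa [one_div, inv_inv] at this
    rw [hfw, levelWeight, levelRatio, ← mul_assoc, hcr]
    simp only [levelSide, Bool.false_eq_true, if_false]
    rw [← Real.mul_rpow (by positivity) (by positivity)]
    have e : 1 / b k * (b k / b (k + 1)) = (b (k + 1))⁻¹ := by field_simp
    rw [e]
    have : (b (k + 1))⁻¹ ≤ r := inv_le_of_inv_le₀ hr0 hk2
    gcongr
    exact hcmono (hb1 k) hinv hk1.le

end Levels

/-! ### Countable suprema and separability -/

/-- Tail bound for a self-similar Gaussian field with stationary rectangular increments over a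
countable subset of the square of side `T`. -/
theorem measure_exists_mem_countable_le {Ω : Type*} [MeasurableSpace Ω] {P : Measure Ω}
    [IsProbabilityMeasure P] {H₁ H₂ : ℝ} {X : ℝ≥0 × ℝ≥0 → Ω → ℝ}
    (hH₁ : H₁ ∈ Set.Ioo (0 : ℝ) 1) (hH₂ : H₂ ∈ Set.Ioo (0 : ℝ) 1)
    (hgauss : IsGaussianProcess X P) (hcentered : ∀ t, ∫ ω, X t ω ∂P = 0)
    (hss : IsSelfSimilarField P X H₁ H₂) (hstat : HasStationaryRectIncrements P X)
    (hnorm : ∫ ω, X (1, 1) ω ^ 2 ∂P = 1) {T u : ℝ} (hT : 0 < T) (hu : 2 ≤ u)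
    {S : Set (ℝ≥0 × ℝ≥0)} (hS : S.Countable) (hST : ∀ t ∈ S, (t.1 : ℝ) ≤ T ∧ (t.2 : ℝ) ≤ T) :
    P {ω | ∃ t ∈ S, 49 / 50 * u * T ^ (H₁ + H₂) < |X t ω|} ≤
      ENNReal.ofReal (8 * Real.exp (2 / min H₁ H₂ + 1 / 2) * u ^ (4 / min H₁ H₂) *
        Real.exp (-(3 / 8 * u ^ 2))) := by
  have hH : 0 < min H₁ H₂ := lt_min hH₁.1 hH₂.1
  have hH1 : min H₁ H₂ < 1 := (min_le_left _ _).trans_lt hH₁.2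
  lift T to ℝ≥0 using hT.le
  have hT' : T ≠ 0 := by rintro rfl; exact lt_irrefl _ hT
  set w : ℝ := (T : ℝ) ^ (H₁ + H₂) with hw
  have hw0 : 0 < w := Real.rpow_pos_of_pos hT _
  set Y : ℝ≥0 × ℝ≥0 → Ω → ℝ := fun t ω => X (T * t.1, T * t.2) ω / w with hY
  have hle : ∀ x : ℝ≥0, x ≤ 1 → ((T * x : ℝ≥0) : ℝ) ≤ T := fun x hx =>
    NNReal.coe_le_coe.2 (mul_le_of_le_one_right zero_le hx)
  have htail : ∀ F : Finset (ℝ≥0 × ℝ≥0), (∀ t ∈ F, t.1 ≤ 1 ∧ t.2 ≤ 1) →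
      P.real {ω | ∃ t ∈ F, 49 / 50 * u < |Y t ω|} ≤
        8 * Real.exp (2 / min H₁ H₂ + 1 / 2) * u ^ (4 / min H₁ H₂) *
          Real.exp (-(3 / 8 * u ^ 2)) := by
    refine fun F hF => measureReal_exists_mem_finset_le hH hH1 ?_ ?_ hu F hF
    · intro t ht1 ht2 v hv
      have hvar : ∫ ω, X (T * t.1, T * t.2) ω ^ 2 ∂P ≤ w ^ 2 := by
        rw [hss.integral_sq_eq hH₁.1 hH₂.1 hnorm, hw, Real.rpow_add hT]
        have := hH₁.1.le
        have := hH₂.1.le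
        gcongr
        · exact hle _ ht1
        · exact hle _ ht2
      have h := HasGaussianLaw.measureReal_le_abs_le (hgauss.hasGaussianLaw_eval _) (hcentered _)
        (pow_pos hw0 2) hvar (mul_nonneg hv hw0.le)
      have e1 : {ω | v ≤ |Y t ω|} = {ω | v * w ≤ |X (T * t.1, T * t.2) ω|} := by
        ext ω
        simp only [hY, Set.mem_ofPred_eq, abs_div, abs_of_pos hw0, le_div_iff₀ hw0]
      rw [e1]
      refine h.trans_eq ?_
      congr 2
      field_simp
    · intro s t hs1 hs2 ht1 ht2 δ hδ hδ1 hd1 hd2 v hv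
      have hd : ∀ x y : ℝ≥0, |(x : ℝ) - y| ≤ δ → |((T * x : ℝ≥0) : ℝ) - (T * y : ℝ≥0)| ≤ T * δ := by
        intro x y h
        rw [NNReal.coe_mul, NNReal.coe_mul, ← mul_sub, abs_mul, abs_of_pos hT]
        gcongr
      have hvar := hstat.integral_sq_sub_le hss hgauss hH₁.1 hH₂.1 hnorm hT hδ hδ1
        (s := (T * s.1, T * s.2)) (t := (T * t.1, T * t.2)) (hle _ hs1) (hle _ ht2)
        (hd _ _ hd1) (hd _ _ hd2)
      have hδH : 0 < δ ^ min H₁ H₂ := Real.rpow_pos_of_pos hδ _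
      have hmean : ∫ ω, (X (T * t.1, T * t.2) ω - X (T * s.1, T * s.2) ω) ∂P = 0 := by
        rw [integral_sub (hgauss.hasGaussianLaw_eval _).integrable
          (hgauss.hasGaussianLaw_eval _).integrable, hcentered, hcentered, sub_zero]
      have h := HasGaussianLaw.measureReal_le_abs_le hgauss.hasGaussianLaw_fun_sub hmean
        (by positivity) hvar (mul_nonneg hv hw0.le)
      have e1 : {ω | v ≤ |Y t ω - Y s ω|} =
          {ω | v * w ≤ |X (T * t.1, T * t.2) ω - X (T * s.1, T * s.2) ω|} := by
        ext ω
        simp only [hY, Set.mem_ofPred_eq, ← sub_div, abs_div, abs_of_pos hw0, le_div_iff₀ hw0]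
      rw [e1]
      refine h.trans_eq ?_
      congr 2
      rw [← hw]
      field_simp
      norm_num
  have hfin : ∀ F : Finset S, P (⋃ t ∈ F, {ω | 49 / 50 * u * w < |X (t : ℝ≥0 × ℝ≥0) ω|}) ≤
      ENNReal.ofReal (8 * Real.exp (2 / min H₁ H₂ + 1 / 2) * u ^ (4 / min H₁ H₂) *
        Real.exp (-(3 / 8 * u ^ 2))) := by
    intro F
    classical
    have h := htail (F.image fun t : S => (t.1.1 / T, t.1.2 / T)) (by
      simp only [Finset.mem_image]
      rintro _ ⟨t, -, rfl⟩
      obtain ⟨h1, h2⟩ := hST t t.2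
      exact ⟨div_le_one_of_le₀ (NNReal.coe_le_coe.1 h1) zero_le,
        div_le_one_of_le₀ (NNReal.coe_le_coe.1 h2) zero_le⟩)
    refine le_trans (measure_mono ?_) ((ENNReal.le_ofReal_iff_toReal_le (measure_ne_top _ _)
      (by positivity)).2 h)
    intro ω hω
    simp only [Set.mem_iUnion, Set.mem_ofPred_eq] at hω
    obtain ⟨t, ht, h⟩ := hω
    refine ⟨_, Finset.mem_image_of_mem _ ht, ?_⟩
    simp only [hY, mul_div_cancel₀ _ hT', abs_div, abs_of_pos hw0, lt_div_iff₀ hw0]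
    exact h
  have : Countable S := hS
  -- A directed union over finite subsets, along which the uniform bound passes to the limit.
  have hset : {ω | ∃ t ∈ S, 49 / 50 * u * w < |X t ω|} =
      ⋃ F : Finset S, ⋃ t ∈ F, {ω | 49 / 50 * u * w < |X (t : ℝ≥0 × ℝ≥0) ω|} := by
    ext ω
    simp only [Set.mem_ofPred_eq, Set.mem_iUnion]
    constructor
    · rintro ⟨t, ht, h⟩
      exact ⟨{⟨t, ht⟩}, ⟨t, ht⟩, Finset.mem_singleton_self _, h⟩
    · rintro ⟨F, t, -, h⟩
      exact ⟨t, t.2, h⟩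
  rw [hset, Directed.measure_iUnion]
  · exact iSup_le hfin
  · classical
    exact directed_of_isDirected_le fun F G hFG => Set.biUnion_subset_biUnion_left hFG

/-- The supremum over a countable set of the field, normalized on each shell by a lower bound of
the weight. -/
noncomputable def levelSup {Ω : Type*} (X : ℝ≥0 × ℝ≥0 → Ω → ℝ) (S : Set (ℝ≥0 × ℝ≥0)) (H₁ H₂ : ℝ)
    (c : ℝ → ℝ) (b : ℕ → ℝ) (ω : Ω) : ℝ≥0∞ :=
  ⨆ i : ℕ × Bool, ⨆ t ∈ {t ∈ S | (t.1 : ℝ) < levelSide b i ∧ (t.2 : ℝ) < levelSide b i},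
    ENNReal.ofReal (|X t ω| / levelWeight H₁ H₂ c b i)

theorem measurable_levelSup {Ω : Type*} [MeasurableSpace Ω] {X : ℝ≥0 × ℝ≥0 → Ω → ℝ}
    {S : Set (ℝ≥0 × ℝ≥0)} (hS : S.Countable) (hX : ∀ t, Measurable (X t)) (H₁ H₂ : ℝ)
    (c : ℝ → ℝ) (b : ℕ → ℝ) : Measurable (levelSup X S H₁ H₂ c b) := by
  refine Measurable.iSup fun i => Measurable.biSup _ (hS.mono (Set.sep_subset _ _)) fun t _ => ?_
  have := hX t
  fun_prop

theorem measure_lt_levelSup_le {Ω : Type*} [MeasurableSpace Ω] {P : Measure Ω}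
    [IsProbabilityMeasure P] {H₁ H₂ : ℝ} {X : ℝ≥0 × ℝ≥0 → Ω → ℝ}
    (hH₁ : H₁ ∈ Set.Ioo (0 : ℝ) 1) (hH₂ : H₂ ∈ Set.Ioo (0 : ℝ) 1)
    (hgauss : IsGaussianProcess X P) (hcentered : ∀ t, ∫ ω, X t ω ∂P = 0)
    (hss : IsSelfSimilarField P X H₁ H₂) (hstat : HasStationaryRectIncrements P X)
    (hnorm : ∫ ω, X (1, 1) ω ^ 2 ∂P = 1) {S : Set (ℝ≥0 × ℝ≥0)} (hS : S.Countable)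
    {c : ℝ → ℝ} {b : ℕ → ℝ} (hb : ∀ k, 0 < b k) {M ε : ℝ} (hM : 0 < M)
    (hm : ∀ k, M ≤ levelRatio H₁ H₂ c b k) (hε : 2 / M < ε)
    (hsum : Summable (ZtildeTerm H₁ H₂ c b ε)) :
    P {ω | ENNReal.ofReal (49 / 50 * ε) < levelSup X S H₁ H₂ c b ω} ≤
      ENNReal.ofReal (Ztilde H₁ H₂ c b ε) := by
  have hε0 : 0 < ε := lt_trans (by positivity) hε
  have hm0 : ∀ k, 0 < levelRatio H₁ H₂ c b k := fun k => hM.trans_le (hm k)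
  set A := 8 * Real.exp (2 / min H₁ H₂ + 1 / 2) * ε ^ (4 / min H₁ H₂) with hA
  have hA0 : 0 ≤ A := by positivity
  have hterm0 : ∀ k, 0 ≤ ZtildeTerm H₁ H₂ c b ε k := fun k => by
    have := hm0 k
    rw [ZtildeTerm]
    positivity
  have hlevel : ∀ i : ℕ × Bool, P {ω | ∃ t ∈ {t ∈ S | (t.1 : ℝ) < levelSide b i ∧
      (t.2 : ℝ) < levelSide b i}, 49 / 50 * ε * levelWeight H₁ H₂ c b i < |X t ω|} ≤
      ENNReal.ofReal (A * ZtildeTerm H₁ H₂ c b ε i.1) := by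
    intro i
    have hu : 2 ≤ ε * levelRatio H₁ H₂ c b i.1 := by
      rw [div_lt_iff₀ hM] at hε
      nlinarith [hm i.1]
    have h := measure_exists_mem_countable_le hH₁ hH₂ hgauss hcentered hss hstat hnorm
      (levelSide_pos hb i) hu (hS.mono (Set.sep_subset _ fun t => (t.1 : ℝ) < levelSide b i ∧
        (t.2 : ℝ) < levelSide b i)) (fun t ht => ⟨ht.2.1.le, ht.2.2.le⟩)
    have e : 49 / 50 * (ε * levelRatio H₁ H₂ c b i.1) * levelSide b i ^ (H₁ + H₂) =
        49 / 50 * ε * levelWeight H₁ H₂ c b i := by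
      rw [levelWeight]
      ring
    rw [e] at h
    exact h.trans (ENNReal.ofReal_le_ofReal
      (supBound_le_ZtildeTerm ((min_le_left _ _).trans_lt hH₁.2) hε0 (hm0 i.1)))
  have hsub : {ω | ENNReal.ofReal (49 / 50 * ε) < levelSup X S H₁ H₂ c b ω} ⊆
      ⋃ i : ℕ × Bool, {ω | ∃ t ∈ {t ∈ S | (t.1 : ℝ) < levelSide b i ∧
      (t.2 : ℝ) < levelSide b i}, 49 / 50 * ε * levelWeight H₁ H₂ c b i < |X t ω|} := by
    intro ω hω
    simp only [levelSup, Set.mem_ofPred_eq, lt_iSup_iff] at hω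
    obtain ⟨i, t, ht, h⟩ := hω
    have hw : 0 < levelWeight H₁ H₂ c b i :=
      mul_pos (Real.rpow_pos_of_pos (levelSide_pos hb i) _) (hm0 i.1)
    refine Set.mem_iUnion.2 ⟨i, t, ht, ?_⟩
    exact (lt_div_iff₀ hw).1 ((ENNReal.ofReal_lt_ofReal_iff_of_nonneg (by positivity)).1 h)
  calc P {ω | ENNReal.ofReal (49 / 50 * ε) < levelSup X S H₁ H₂ c b ω}
      ≤ ∑' i : ℕ × Bool, ENNReal.ofReal (A * ZtildeTerm H₁ H₂ c b ε i.1) :=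
        (measure_mono hsub).trans ((measure_iUnion_le _).trans (ENNReal.tsum_le_tsum hlevel))
    -- Each `k` counts twice, for the shell outside the unit square and its reflection inside: `16 =
    -- 2 · 8`.
    _ = ∑' k, ENNReal.ofReal (2 * (A * ZtildeTerm H₁ H₂ c b ε k)) := by
        rw [ENNReal.tsum_prod (f := fun k (_ : Bool) => ENNReal.ofReal (A * ZtildeTerm H₁ H₂ c b ε k))]
        refine tsum_congr fun k => ?_
        have := mul_nonneg hA0 (hterm0 k)
        rw [tsum_bool, ← ENNReal.ofReal_add this this, two_mul]
    _ = ENNReal.ofReal (∑' k, 2 * (A * ZtildeTerm H₁ H₂ c b ε k)) :=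
        (ENNReal.ofReal_tsum_of_nonneg (fun k => by have := hterm0 k; positivity)
          ((hsum.mul_left A).mul_left 2)).symm
    _ = ENNReal.ofReal (Ztilde H₁ H₂ c b ε) := by
        rw [tsum_mul_left, tsum_mul_left, Ztilde, hA]
        congr 1
        ring

/-- Separability carries the bound by the countable supremum over to the whole quadrant. -/
theorem ofReal_abs_div_fieldWeight_le_levelSup {Ω : Type*} {H₁ H₂ : ℝ} {X : ℝ≥0 × ℝ≥0 → Ω → ℝ}
    {S : Set (ℝ≥0 × ℝ≥0)} {c : ℝ → ℝ} {b : ℕ → ℝ} {ω : Ω}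
    (hsep : ∀ G : Set (ℝ≥0 × ℝ≥0), IsOpen G → ∀ F : Set ℝ, IsClosed F →
      (∀ t ∈ G ∩ S, X t ω ∈ F) → ∀ t ∈ G, X t ω ∈ F)
    {i : ℕ × Bool} {t : ℝ≥0 × ℝ≥0} (hw : 0 < levelWeight H₁ H₂ c b i)
    (ht₁ : (t.1 : ℝ) < levelSide b i) (ht₂ : (t.2 : ℝ) < levelSide b i)
    (hfw : levelWeight H₁ H₂ c b i ≤ fieldWeight H₁ H₂ c t) :
    ENNReal.ofReal (|X t ω| / fieldWeight H₁ H₂ c t) ≤ levelSup X S H₁ H₂ c b ω := by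
  rcases eq_or_ne (levelSup X S H₁ H₂ c b ω) ∞ with htop | htop
  · rw [htop]
    exact le_top
  set y := (levelSup X S H₁ H₂ c b ω).toReal with hy
  have hG : IsOpen {t : ℝ≥0 × ℝ≥0 | (t.1 : ℝ) < levelSide b i ∧ (t.2 : ℝ) < levelSide b i} :=
    IsOpen.and (isOpen_lt (NNReal.continuous_coe.comp continuous_fst) continuous_const)
      (isOpen_lt (NNReal.continuous_coe.comp continuous_snd) continuous_const)
  have h := hsep _ hG {x | |x| ≤ y * levelWeight H₁ H₂ c b i}
    (isClosed_le continuous_abs continuous_const) (by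
      rintro s ⟨⟨hs1, hs2⟩, hs⟩
      have h1 : ENNReal.ofReal (|X s ω| / levelWeight H₁ H₂ c b i) ≤ levelSup X S H₁ H₂ c b ω :=
        le_iSup_of_le i (le_iSup₂_of_le (f := fun (t : ℝ≥0 × ℝ≥0) _ =>
          ENNReal.ofReal (|X t ω| / levelWeight H₁ H₂ c b i)) s ⟨hs, hs1, hs2⟩ le_rfl)
      exact (div_le_iff₀ hw).1 ((ENNReal.ofReal_le_iff_le_toReal htop).1 h1)) t ⟨ht₁, ht₂⟩
  refine (ENNReal.ofReal_le_iff_le_toReal htop).2 ?_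
  refine (div_le_div_of_nonneg_left (abs_nonneg _) hw hfw).trans ?_
  exact (div_le_iff₀ hw).2 h

/-! ### The main theorem -/

theorem mainTheorem1 {Ω : Type*} [MeasurableSpace Ω] (P : Measure Ω) [IsProbabilityMeasure P]
    (H₁ H₂ : ℝ) (hH₁ : H₁ ∈ Set.Ioo (0 : ℝ) 1) (hH₂ : H₂ ∈ Set.Ioo (0 : ℝ) 1)
    (X : ℝ≥0 × ℝ≥0 → Ω → ℝ)
    (hgauss : IsGaussianProcess X P)
    (hcentered : ∀ t, ∫ ω, X t ω ∂P = 0)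
    (hsep : IsSeparableField P X)
    (hss : IsSelfSimilarField P X H₁ H₂)
    (hstat : HasStationaryRectIncrements P X)
    (hnorm : ∫ ω, X (1, 1) ω ^ 2 ∂P = 1)
    (c : ℝ → ℝ) (hcpos : ∀ t, 0 < t → 0 < c t)
    (hcmono : MonotoneOn c (Set.Ici 1))
    (hctop : Tendsto c atTop atTop)
    (hcinv : ∀ t, 1 ≤ t → c (1 / t) = c t)
    (b : ℕ → ℝ) (hb0 : b 0 = 1) (hbmono : StrictMono b) (hbtop : Tendsto b atTop atTop)
    (M : ℝ) (hM : M = ⨅ k, levelRatio H₁ H₂ c b k) (hMpos : 0 < M)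
    (hseries : ∀ D : ℝ, 0 < D →
      Summable (fun k : ℕ => Real.exp (-(D * levelRatio H₁ H₂ c b (k + 1))))) :
    (∀ ε : ℝ, 2 / M < ε →
      Summable (ZtildeTerm H₁ H₂ c b ε) ∧
      P {ω | (ε : EReal) < normalizedSup X H₁ H₂ c ω} ≤ ENNReal.ofReal (Ztilde H₁ H₂ c b ε)) ∧
    ∃ ξ : Ω → ℝ, Measurable ξ ∧
      (∀ᵐ ω ∂P, ∀ t : ℝ≥0 × ℝ≥0, 0 < t.1 → 0 < t.2 →
        |X t ω| < ξ ω * fieldWeight H₁ H₂ c t) ∧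
      ∀ ε : ℝ, 2 / M < ε →
        P {ω | ε < ξ ω} ≤ ENNReal.ofReal (Ztilde H₁ H₂ c b ε) := by
  have hH : 0 < min H₁ H₂ := lt_min hH₁.1 hH₂.1
  have hb : ∀ k, 0 < b k := fun k =>
    one_pos.trans_le (hb0 ▸ hbmono.monotone (Nat.zero_le k))
  have hm : ∀ k, M ≤ levelRatio H₁ H₂ c b k := fun k => by
    rw [hM]
    refine ciInf_le ⟨0, ?_⟩ k
    rintro _ ⟨j, rfl⟩
    have h1 := hb j
    have h2 := hb (j + 1)
    have h3 := hcpos _ h1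
    dsimp only
    rw [levelRatio]
    positivity
  have hsum : ∀ ε, 2 / M < ε → Summable (ZtildeTerm H₁ H₂ c b ε) := fun ε hε =>
    summable_ZtildeTerm hH hMpos hm hseries (lt_trans (by positivity) hε)
  have hw : ∀ i, 0 < levelWeight H₁ H₂ c b i := fun i =>
    mul_pos (Real.rpow_pos_of_pos (levelSide_pos hb i) _) (hMpos.trans_le (hm i.1))
  obtain ⟨S, hS, -, hsepS⟩ := hsep
  set L := levelSup X S H₁ H₂ c b with hL
  have hbound : ∀ ε, 2 / M < ε →
      P {ω | ENNReal.ofReal (49 / 50 * ε) < L ω} ≤ ENNReal.ofReal (Ztilde H₁ H₂ c b ε) :=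
    fun ε hε => measure_lt_levelSup_le hH₁ hH₂ hgauss hcentered hss hstat hnorm hS hb hMpos hm hε
      (hsum ε hε)
  have hdom : ∀ᵐ ω ∂P, ∀ t : ℝ≥0 × ℝ≥0, t ≠ 0 → 0 < fieldWeight H₁ H₂ c t ∧
      ENNReal.ofReal (|X t ω| / fieldWeight H₁ H₂ c t) ≤ L ω := by
    filter_upwards [hsepS] with ω hω t ht
    obtain ⟨i, h1, h2, h3⟩ := exists_levelWeight_le_fieldWeight (add_pos hH₁.1 hH₂.1) hcpos
      hcmono hcinv hb0 hbmono hbtop ht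
    exact ⟨(hw i).trans_le h3, ofReal_abs_div_fieldWeight_le_levelSup hω (hw i) h1 h2 h3⟩
  have hfinite : ∀ᵐ ω ∂P, L ω ≠ ∞ := by
    have hle : ∀ᶠ ε in atTop, P {ω | L ω = ∞} ≤ ENNReal.ofReal (Ztilde H₁ H₂ c b ε) := by
      filter_upwards [eventually_gt_atTop (2 / M)] with ε hε
      refine (measure_mono fun ω (hω : L ω = ∞) => ?_).trans (hbound ε hε)
      rw [Set.mem_ofPred_eq, hω]
      exact ENNReal.ofReal_lt_top
    have hlim := (ENNReal.tendsto_ofReal (tendsto_Ztilde_atTop hH hMpos hm hseries))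
    rw [ENNReal.ofReal_zero] at hlim
    rw [ae_iff]
    simpa using ge_of_tendsto hlim hle
  refine ⟨fun ε hε => ⟨hsum ε hε, ?_⟩, ?_⟩
  · have hε0 : 0 < ε := lt_trans (by positivity) hε
    refine (measure_mono_ae ?_).trans (hbound ε hε)
    filter_upwards [hdom] with ω hω hlt
    obtain ⟨⟨t, ht⟩, h⟩ := lt_iSup_iff.1 hlt
    have h' : ε < |X t ω| / fieldWeight H₁ H₂ c t := EReal.coe_lt_coe_iff.1 h
    refine lt_of_lt_of_le ?_ (hω t ht).2
    exact (ENNReal.ofReal_lt_ofReal_iff (hε0.trans h')).2 (by linarith)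
  -- The values of the field are only almost everywhere measurable. Measurable versions agree with
  -- them almost surely on the countable set `S`, which makes `ξ` measurable.
  · set X' : ℝ≥0 × ℝ≥0 → Ω → ℝ := fun t => (hgauss.aemeasurable t).mk (X t) with hX'
    set L' := levelSup X' S H₁ H₂ c b with hL'
    have hmeas : Measurable L' :=
      measurable_levelSup hS (fun t => (hgauss.aemeasurable t).measurable_mk) _ _ _ _
    have hae : ∀ᵐ ω ∂P, L ω = L' ω := by
      have : ∀ᵐ ω ∂P, ∀ t ∈ S, X t ω = X' t ω :=
        (ae_ball_iff hS).2 fun t _ => (hgauss.aemeasurable t).ae_eq_mk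
      filter_upwards [this] with ω hω
      refine iSup_congr fun i => iSup_congr fun t => iSup_congr fun ht => ?_
      rw [hω t ht.1]
    -- The factor 50/49 gives strictness when the supremum is positive, and `2 / M` when it is zero;
    -- the latter does not affect `{ξ > ε}` for `ε > 2 / M`.
    refine ⟨fun ω => max (50 / 49 * (L' ω).toReal) (2 / M), ?_, ?_, ?_⟩
    · exact (hmeas.ennreal_toReal.const_mul _).max measurable_const
    · filter_upwards [hdom, hfinite, hae] with ω h1 h2 h3 t ht1 ht2
      have ht : t ≠ 0 := by
        rintro rfl
        exact lt_irrefl _ ht1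
      obtain ⟨hpos, h⟩ := h1 t ht
      rw [← h3]
      rw [ENNReal.ofReal_le_iff_le_toReal h2, div_le_iff₀ hpos] at h
      refine h.trans_lt (mul_lt_mul_of_pos_right ?_ hpos)
      have hM2 : 0 < 2 / M := by positivity
      rcases (ENNReal.toReal_nonneg (a := L ω)).eq_or_lt with h0 | h0
      · rw [← h0]
        exact lt_max_of_lt_right hM2
      · exact lt_max_of_lt_left (by linarith)
    · intro ε hε
      refine (measure_mono_ae ?_).trans (hbound ε hε)
      filter_upwards [hae] with ω h3 hlt
      have hε0 : 0 < ε := lt_trans (by positivity) hε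
      have h : ε < 50 / 49 * (L ω).toReal := by
        rcases lt_max_iff.1 (show ε < max (50 / 49 * (L' ω).toReal) (2 / M) from hlt) with h | h
        · rwa [h3]
        · exact absurd h (not_lt.2 hε.le)
      change ENNReal.ofReal (49 / 50 * ε) < L ω
      -- `toReal` sends `∞` to 0, which `ε > 0` excludes.
      have hne : L ω ≠ ∞ := fun h0 => by
        rw [h0, ENNReal.toReal_top] at h
        linarith
      rw [ENNReal.ofReal_lt_iff_lt_toReal (by positivity) hne]
      linarith
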